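/- Let $X$ be a smooth complex surface and let $C=\sum_{i=1}^n C_i\subset X$ be a connected compact curve with simple normal crossing singularities, each irreducible component $C_i$ being a smooth (connected) curve; two components may meet in several points. Let $\Gamma$ be the dual graph of $C$: its vertices are the components $C_1,\dots,C_n$, and for $i<j$ its edges from $C_i$ to $C_j$ are the points of $C_i\cap C_j$. For $Z=C$ or $Z=C_i$, let $\mathrm{Pic}(Z)$ be the group of isomorphism classes of holomorphic line bundles on $Z$ under the tensor product, and let \[ T(C)=\{F\in \mathrm{Pic}(C) : F|_{C_i}\cong\mathcal O_{C_i},\ i=1,\dots,n\}. \] Let $H^1(\Gamma,\mathbb C^*)$ be the first cohomology group of the graph $\Gamma$, that is, the cokernel of the coboundary map from functions on the vertices to functions on the edges with values in $\mathbb C^*$, and let $\pi_1(\Gamma)=\pi_1(\Gamma,v)$ be the fundamental group of $\Gamma$ (classes of closed edge paths) at an arbitrary vertex $v$. Then there are isomorphisms of groups \[ T(C)\simeq H^1(\Gamma,\mathbb C^*)\simeq \mathrm{Hom}(\pi_1(\Gamma),\mathbb C^*). \] -/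

import Mathlib

open scoped Manifold ContDiff

universe u

/-! ## Holomorphic functions and line bundles on subsets of a complex surface -/

section Picard

variable {X : Type u} [TopologicalSpace X] [ChartedSpace (ℂ × ℂ) X]

/-- Let `Z` be a subset of a complex surface `X` and `V ⊆ X` an open set. The function `f` is
holomorphic on the relatively open set `Z ∩ V` of `Z` if near each point of `Z ∩ V` it is the
restriction of a holomorphic function on an open subset of `X`. For a reduced analytic subset `Z`
with ideal sheaf `I`, these are the sections over `Z ∩ V` of `𝒪_Z = 𝒪_X / I`.
Only the values of `f` on `Z ∩ V` matter. -/
def HolomorphicOn (Z V : Set X) (f : X → ℂ) : Prop :=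
  ∀ p ∈ Z ∩ V, ∃ W : Set X, IsOpen W ∧ p ∈ W ∧ ∃ F : X → ℂ,
    MDifferentiableOn 𝓘(ℂ, ℂ × ℂ) 𝓘(ℂ, ℂ) F W ∧ ∀ q ∈ W ∩ Z, F q = f q

namespace HolomorphicOn

variable {Z V : Set X} {f g : X → ℂ}

theorem const (Z V : Set X) (c : ℂ) : HolomorphicOn Z V fun _ => c := fun p _ =>
  ⟨Set.univ, isOpen_univ, Set.mem_univ p, fun _ => c, mdifferentiableOn_const, fun _ _ => rfl⟩

theorem mul (hf : HolomorphicOn Z V f) (hg : HolomorphicOn Z V g) :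
    HolomorphicOn Z V fun q => f q * g q := by
  intro p hp
  obtain ⟨W, hW, hpW, F, hF, hFf⟩ := hf p hp
  obtain ⟨W', hW', hpW', G, hG, hGg⟩ := hg p hp
  refine ⟨W ∩ W', hW.inter hW', ⟨hpW, hpW'⟩, F * G,
    (hF.mono Set.inter_subset_left).mul (hG.mono Set.inter_subset_right), fun q hq => ?_⟩
  simp [hFf q ⟨hq.1.1, hq.2⟩, hGg q ⟨hq.1.2, hq.2⟩]

theorem mono {Z' V' : Set X} (hf : HolomorphicOn Z V f) (hZ : Z' ⊆ Z) (hV : V' ⊆ V) :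
    HolomorphicOn Z' V' f := by
  intro p hp
  obtain ⟨W, hW, hpW, F, hF, hFf⟩ := hf p ⟨hZ hp.1, hV hp.2⟩
  exact ⟨W, hW, hpW, F, hF, fun q hq => hFf q ⟨hq.1, hZ hq.2⟩⟩

theorem inv {u : X → ℂˣ} (hu : HolomorphicOn Z V fun q => (u q : ℂ)) :
    HolomorphicOn Z V fun q => ((u q)⁻¹ : ℂˣ) := by
  intro p hp
  obtain ⟨W, hW, hpW, F, hF, hFf⟩ := hu p hp
  refine ⟨W ∩ F ⁻¹' {0}ᶜ, hF.continuousOn.isOpen_inter_preimage hW isOpen_compl_singleton,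
    ⟨hpW, ?_⟩, fun q => (F q)⁻¹, (hF.mono Set.inter_subset_left).inv fun z hz => hz.2,
    fun q hq => ?_⟩
  · simp [hFf p ⟨hpW, hp.1⟩]
  · simp [hFf q ⟨hq.1.1, hq.2⟩]

/-- Holomorphy is local. -/
theorem of_local
    (h : ∀ p ∈ Z ∩ V, ∃ V' : Set X, IsOpen V' ∧ p ∈ V' ∧ ∃ f' : X → ℂ,
      HolomorphicOn Z V' f' ∧ ∀ q ∈ Z ∩ V ∩ V', f' q = f q) (hV : IsOpen V) :
    HolomorphicOn Z V f := by
  intro p hp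
  obtain ⟨V', hV', hpV', f', hf', he⟩ := h p hp
  obtain ⟨W, hW, hpW, F, hF, hFf⟩ := hf' p ⟨hp.1, hpV'⟩
  exact ⟨W ∩ (V ∩ V'), hW.inter (hV.inter hV'), ⟨hpW, hp.2, hpV'⟩, F,
    hF.mono Set.inter_subset_left,
    fun q hq => (hFf q ⟨hq.1.1, hq.2⟩).trans (he q ⟨⟨hq.2, hq.1.2.1⟩, hq.1.2.2⟩)⟩

end HolomorphicOn

/-- A holomorphic line bundle on `Z ⊆ X`, given by an open cover `U i` of `Z` and nowhere vanishing
holomorphic transition functions `g i j` on `Z ∩ U i ∩ U j` that satisfy the cocycle identity.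
(Values of `g i j` outside `Z ∩ U i ∩ U j` are irrelevant.) -/
structure HolLineBundle (Z : Set X) where
  ι : Type u
  U : ι → Set X
  isOpen_U : ∀ i, IsOpen (U i)
  cover : ∀ p ∈ Z, ∃ i, p ∈ U i
  g : ι → ι → X → ℂˣ
  holomorphic_g : ∀ i j, HolomorphicOn Z (U i ∩ U j) fun q => (g i j q : ℂ)
  cocycle : ∀ i j k, ∀ q ∈ Z, q ∈ U i → q ∈ U j → q ∈ U k → g i j q * g j k q = g i k q

namespace HolLineBundle

variable {Z : Set X}

/-- An isomorphism of holomorphic line bundles on `Z`: with respect to the local frames of `L` over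
`Z ∩ L.U i` and of `M` over `Z ∩ M.U k` it is given by a nowhere vanishing holomorphic function
`φ i k` on `Z ∩ L.U i ∩ M.U k`, and these functions are compatible with the transition functions. -/
structure Iso (L M : HolLineBundle Z) where
  φ : L.ι → M.ι → X → ℂˣ
  holomorphic_φ : ∀ i k, HolomorphicOn Z (L.U i ∩ M.U k) fun q => (φ i k q : ℂ)
  compat : ∀ i j k l, ∀ q ∈ Z, q ∈ L.U i → q ∈ L.U j → q ∈ M.U k → q ∈ M.U l →
    φ i k q * M.g k l q = L.g i j q * φ j l q

theorem g_self (L : HolLineBundle Z) {i : L.ι} {q : X} (hq : q ∈ Z) (hi : q ∈ L.U i) :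
    L.g i i q = 1 := by
  have := L.cocycle i i i q hq hi hi hi
  simpa using this

/-- The identity isomorphism. -/
def Iso.refl (L : HolLineBundle Z) : Iso L L where
  φ := L.g
  holomorphic_φ := L.holomorphic_g
  compat i j k l q hq hi hj hk hl := by
    rw [L.cocycle i k l q hq hi hk hl, L.cocycle i j l q hq hi hj hl]

/-- The inverse isomorphism. -/
def Iso.symm {L M : HolLineBundle Z} (e : Iso L M) : Iso M L where
  φ k i q := (e.φ i k q)⁻¹
  holomorphic_φ k i := (e.holomorphic_φ i k).inv.mono subset_rfl fun _ h => ⟨h.2, h.1⟩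
  compat k l i j q hq hk hl hi hj := by
    rw [inv_mul_eq_iff_eq_mul, ← mul_assoc, e.compat i j k l q hq hi hj hk hl,
      mul_inv_cancel_right]

/-- Isomorphisms can be composed. -/
theorem Iso.trans {L M N : HolLineBundle Z} (e : Iso L M) (f : Iso M N) :
    Nonempty (Iso L N) := by
  classical
  -- the composite is locally `e.φ i k * f.φ k a`, which does not depend on `k`
  have indep : ∀ i k l a, ∀ q ∈ Z, q ∈ L.U i → q ∈ M.U k → q ∈ M.U l → q ∈ N.U a →
      e.φ i k q * f.φ k a q = e.φ i l q * f.φ l a q := by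
    intro i k l a q hq hi hk hl ha
    have h1 := e.compat i i k l q hq hi hi hk hl
    have h2 := f.compat k l a a q hq hk hl ha ha
    rw [g_self L hq hi, one_mul] at h1
    rw [g_self N hq ha, mul_one] at h2
    rw [← h1, h2, mul_assoc]
  have hex : ∀ q : X, ∃ s : Option M.ι, ∀ _ : q ∈ Z, ∃ k, s = some k ∧ q ∈ M.U k := by
    intro q
    by_cases hq : q ∈ Z
    · obtain ⟨k, hk⟩ := M.cover q hq
      exact ⟨some k, fun _ => ⟨k, rfl, hk⟩⟩
    · exact ⟨none, fun h => absurd h hq⟩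
  choose s hs using hex
  let ψ : L.ι → N.ι → X → ℂˣ := fun i a q =>
    (s q).elim 1 fun k => e.φ i k q * f.φ k a q
  have hψ : ∀ i k a, ∀ q ∈ Z, q ∈ L.U i → q ∈ M.U k → q ∈ N.U a →
      ψ i a q = e.φ i k q * f.φ k a q := by
    intro i k a q hq hi hk ha
    obtain ⟨l, hl, hql⟩ := hs q hq
    simp only [ψ, hl, Option.elim_some]
    exact indep i l k a q hq hi hql hk ha
  refine ⟨⟨ψ, fun i a => ?_, fun i j a b q hq hi hj ha hb => ?_⟩⟩
  · refine HolomorphicOn.of_local (fun p hp => ?_) ((L.isOpen_U i).inter (N.isOpen_U a))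
    obtain ⟨k, hk⟩ := M.cover p hp.1
    refine ⟨L.U i ∩ M.U k ∩ N.U a, ((L.isOpen_U i).inter (M.isOpen_U k)).inter (N.isOpen_U a),
      ⟨⟨hp.2.1, hk⟩, hp.2.2⟩, fun q => (e.φ i k q : ℂ) * f.φ k a q,
      ((e.holomorphic_φ i k).mono subset_rfl fun _ h => h.1).mul
        ((f.holomorphic_φ k a).mono subset_rfl fun _ h => ⟨h.1.2, h.2⟩), fun q hq => ?_⟩
    rw [hψ i k a q hq.1.1 hq.2.1.1 hq.2.1.2 hq.2.2, Units.val_mul]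
  · obtain ⟨k, hk⟩ := M.cover q hq
    rw [hψ i k a q hq hi hk ha, hψ j k b q hq hj hk hb, mul_assoc,
      f.compat k k a b q hq hk hk ha hb, g_self M hq hk, one_mul, ← mul_assoc]
    have h1 := e.compat i j k k q hq hi hj hk hk
    rw [g_self M hq hk, mul_one] at h1
    rw [h1]

/-- The relation of being isomorphic. -/
instance setoid (Z : Set X) : Setoid (HolLineBundle Z) where
  r L M := Nonempty (Iso L M)
  iseqv := ⟨fun L => ⟨Iso.refl L⟩, fun ⟨e⟩ => ⟨e.symm⟩, fun ⟨e⟩ ⟨f⟩ => e.trans f⟩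

/-- The trivial line bundle `𝒪_Z`. -/
def trivial (Z : Set X) : HolLineBundle Z where
  ι := PUnit
  U _ := Set.univ
  isOpen_U _ := isOpen_univ
  cover _ _ := ⟨⟨⟩, Set.mem_univ _⟩
  g _ _ _ := 1
  holomorphic_g _ _ := HolomorphicOn.const _ _ _
  cocycle _ _ _ _ _ _ _ _ := one_mul 1

/-- The tensor product of two line bundles. -/
def tensor (L M : HolLineBundle Z) : HolLineBundle Z where
  ι := L.ι × M.ι
  U i := L.U i.1 ∩ M.U i.2
  isOpen_U i := (L.isOpen_U i.1).inter (M.isOpen_U i.2)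
  cover p hp := by
    obtain ⟨i, hi⟩ := L.cover p hp
    obtain ⟨k, hk⟩ := M.cover p hp
    exact ⟨(i, k), hi, hk⟩
  g i j q := L.g i.1 j.1 q * M.g i.2 j.2 q
  holomorphic_g i j := by
    simp only [Units.val_mul]
    exact ((L.holomorphic_g i.1 j.1).mono subset_rfl fun _ h => ⟨h.1.1, h.2.1⟩).mul
      ((M.holomorphic_g i.2 j.2).mono subset_rfl fun _ h => ⟨h.1.2, h.2.2⟩)
  cocycle i j k q hq hi hj hk := by
    rw [mul_mul_mul_comm, L.cocycle _ _ _ q hq hi.1 hj.1 hk.1, M.cocycle _ _ _ q hq hi.2 hj.2 hk.2]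

/-- The dual of a line bundle. -/
def dual (L : HolLineBundle Z) : HolLineBundle Z where
  ι := L.ι
  U := L.U
  isOpen_U := L.isOpen_U
  cover := L.cover
  g i j q := (L.g i j q)⁻¹
  holomorphic_g i j := (L.holomorphic_g i j).inv
  cocycle i j k q hq hi hj hk := by rw [← mul_inv, L.cocycle i j k q hq hi hj hk]

/-- The restriction of a line bundle to a subset. -/
def restrict {Z' : Set X} (h : Z' ⊆ Z) (L : HolLineBundle Z) : HolLineBundle Z' where
  ι := L.ι
  U := L.U
  isOpen_U := L.isOpen_U
  cover p hp := L.cover p (h hp)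
  g := L.g
  holomorphic_g i j := (L.holomorphic_g i j).mono h subset_rfl
  cocycle i j k q hq := L.cocycle i j k q (h hq)

/-- Tensor products of isomorphisms. -/
def Iso.tensor {L L' M M' : HolLineBundle Z} (e : Iso L L') (f : Iso M M') :
    Iso (L.tensor M) (L'.tensor M') where
  φ i k q := e.φ i.1 k.1 q * f.φ i.2 k.2 q
  holomorphic_φ i k := by
    simp only [Units.val_mul]
    exact ((e.holomorphic_φ i.1 k.1).mono subset_rfl fun _ h => ⟨h.1.1, h.2.1⟩).mul
      ((f.holomorphic_φ i.2 k.2).mono subset_rfl fun _ h => ⟨h.1.2, h.2.2⟩)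
  compat i j k l q hq hi hj hk hl := by
    simp only [HolLineBundle.tensor]
    rw [mul_mul_mul_comm, e.compat _ _ _ _ q hq hi.1 hj.1 hk.1 hl.1,
      f.compat _ _ _ _ q hq hi.2 hj.2 hk.2 hl.2, mul_mul_mul_comm]

/-- Duals of isomorphisms. -/
def Iso.dual {L M : HolLineBundle Z} (e : Iso L M) : Iso L.dual M.dual where
  φ i k q := (e.φ i k q)⁻¹
  holomorphic_φ i k := (e.holomorphic_φ i k).inv
  compat i j k l q hq hi hj hk hl := by
    simp only [HolLineBundle.dual]
    rw [← mul_inv, e.compat i j k l q hq hi hj hk hl, mul_inv]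

/-- Restrictions of isomorphisms. -/
def Iso.restrict {Z' : Set X} (h : Z' ⊆ Z) {L M : HolLineBundle Z} (e : Iso L M) :
    Iso (L.restrict h) (M.restrict h) where
  φ := e.φ
  holomorphic_φ i k := (e.holomorphic_φ i k).mono h subset_rfl
  compat i j k l q hq := e.compat i j k l q (h hq)

/-- Associativity of the tensor product. -/
def Iso.assoc (L M N : HolLineBundle Z) :
    Iso ((L.tensor M).tensor N) (L.tensor (M.tensor N)) where
  φ i k q := L.g i.1.1 k.1 q * M.g i.1.2 k.2.1 q * N.g i.2 k.2.2 q
  holomorphic_φ i k := by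
    simp only [Units.val_mul]
    exact (((L.holomorphic_g _ _).mono subset_rfl fun _ h => ⟨h.1.1.1, h.2.1⟩).mul
      ((M.holomorphic_g _ _).mono subset_rfl fun _ h => ⟨h.1.1.2, h.2.2.1⟩)).mul
      ((N.holomorphic_g _ _).mono subset_rfl fun _ h => ⟨h.1.2, h.2.2.2⟩)
  compat i j k l q hq hi hj hk hl := by
    have h1 := (Iso.refl L).compat _ _ _ _ q hq hi.1.1 hj.1.1 hk.1 hl.1
    have h2 := (Iso.refl M).compat _ _ _ _ q hq hi.1.2 hj.1.2 hk.2.1 hl.2.1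
    have h3 := (Iso.refl N).compat _ _ _ _ q hq hi.2 hj.2 hk.2.2 hl.2.2
    simp only [Iso.refl] at h1 h2 h3
    simp only [HolLineBundle.tensor]
    rw [← mul_assoc (L.g k.1 l.1 q), mul_mul_mul_comm, mul_mul_mul_comm (L.g _ _ q), h1, h2, h3,
      mul_mul_mul_comm (L.g _ _ q), mul_mul_mul_comm]

/-- Commutativity of the tensor product. -/
def Iso.comm (L M : HolLineBundle Z) : Iso (L.tensor M) (M.tensor L) where
  φ i k q := L.g i.1 k.2 q * M.g i.2 k.1 q
  holomorphic_φ i k := by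
    simp only [Units.val_mul]
    exact ((L.holomorphic_g _ _).mono subset_rfl fun _ h => ⟨h.1.1, h.2.2⟩).mul
      ((M.holomorphic_g _ _).mono subset_rfl fun _ h => ⟨h.1.2, h.2.1⟩)
  compat i j k l q hq hi hj hk hl := by
    have h1 := (Iso.refl L).compat _ _ _ _ q hq hi.1 hj.1 hk.2 hl.2
    have h2 := (Iso.refl M).compat _ _ _ _ q hq hi.2 hj.2 hk.1 hl.1
    simp only [Iso.refl] at h1 h2
    simp only [HolLineBundle.tensor]
    rw [mul_comm (M.g k.1 l.1 q), mul_mul_mul_comm, h1, h2, mul_mul_mul_comm]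

/-- The trivial bundle is neutral. -/
def Iso.trivialTensor (L : HolLineBundle Z) : Iso ((trivial Z).tensor L) L where
  φ i k q := L.g i.2 k q
  holomorphic_φ i k := (L.holomorphic_g _ _).mono subset_rfl fun _ h => ⟨h.1.2, h.2⟩
  compat i j k l q hq hi hj hk hl := by
    simp only [HolLineBundle.tensor, trivial, one_mul]
    exact (Iso.refl L).compat _ _ _ _ q hq hi.2 hj.2 hk hl

/-- The dual is the inverse for the tensor product. -/
def Iso.dualTensor (L : HolLineBundle Z) : Iso (L.dual.tensor L) (trivial Z) where
  φ i _ q := (L.g i.1 i.2 q)⁻¹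
  holomorphic_φ i _ := (L.holomorphic_g _ _).inv.mono subset_rfl fun _ h => h.1
  compat i j k l q hq hi hj hk hl := by
    have h1 := (Iso.refl L).compat _ _ _ _ q hq hi.1 hj.1 hi.2 hj.2
    simp only [Iso.refl] at h1
    change (L.g i.1 i.2 q)⁻¹ * 1 = (L.g i.1 j.1 q)⁻¹ * L.g i.2 j.2 q * (L.g j.1 j.2 q)⁻¹
    rw [mul_one, eq_mul_inv_iff_mul_eq, inv_mul_eq_iff_eq_mul, mul_comm (L.g i.1 j.1 q)⁻¹,
      ← mul_assoc, h1, mul_comm (L.g i.1 j.1 q), mul_inv_cancel_right]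

end HolLineBundle

/-- The Picard group of `Z`: isomorphism classes of holomorphic line bundles on `Z`. -/
def Pic (Z : Set X) : Type (u + 1) := Quotient (HolLineBundle.setoid Z)

namespace Pic

variable {Z : Set X}

/-- The isomorphism class of a line bundle. -/
def mk (L : HolLineBundle Z) : Pic Z := Quotient.mk _ L

theorem mk_eq_mk_iff {L M : HolLineBundle Z} : mk L = mk M ↔ Nonempty (L.Iso M) :=
  Quotient.eq

/-- The Picard group is an abelian group under the tensor product. -/
instance : CommGroup (Pic Z) where
  mul := Quotient.map₂ HolLineBundle.tensor fun _ _ ⟨e⟩ _ _ ⟨f⟩ => ⟨e.tensor f⟩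
  one := mk (HolLineBundle.trivial Z)
  inv := Quotient.map HolLineBundle.dual fun _ _ ⟨e⟩ => ⟨e.dual⟩
  mul_assoc := by
    rintro ⟨L⟩ ⟨M⟩ ⟨N⟩
    exact Quotient.sound ⟨HolLineBundle.Iso.assoc L M N⟩
  mul_comm := by
    rintro ⟨L⟩ ⟨M⟩
    exact Quotient.sound ⟨HolLineBundle.Iso.comm L M⟩
  one_mul := by
    rintro ⟨L⟩
    exact Quotient.sound ⟨HolLineBundle.Iso.trivialTensor L⟩
  mul_one := by
    rintro ⟨L⟩
    exact Quotient.sound ((HolLineBundle.Iso.comm L _).trans (HolLineBundle.Iso.trivialTensor L))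
  inv_mul_cancel := by
    rintro ⟨L⟩
    exact Quotient.sound ⟨HolLineBundle.Iso.dualTensor L⟩

/-- Restriction of line bundles to a subset, `F ↦ F|_{Z'}`, as a group homomorphism. -/
def restrict {Z' : Set X} (h : Z' ⊆ Z) : Pic Z →* Pic Z' where
  toFun := Quotient.map (HolLineBundle.restrict h) fun _ _ ⟨e⟩ => ⟨e.restrict h⟩
  map_one' := rfl
  map_mul' := by
    rintro ⟨L⟩ ⟨M⟩
    rfl

end Pic

/-! ## Curves with simple normal crossings -/

/-- `C = C 0 + ⋯ + C (n - 1)` is a connected compact curve in the complex surface `X` with simple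
normal crossings and smooth irreducible components `C i`: the components are connected, and every
point `p` of the curve is the centre of a holomorphic chart `(z, w)` of `X` in which either only one
component occurs, with equation `z = 0`, or exactly two components occur, with equations `z = 0`
and `w = 0`. -/
structure IsSNCCurve {n : ℕ} (C : Fin n → Set X) : Prop where
  isCompact : IsCompact (⋃ i, C i)
  isConnected : IsConnected (⋃ i, C i)
  isConnected_component : ∀ i, IsConnected (C i)
  exists_chart : ∀ p ∈ ⋃ i, C i, ∃ χ ∈ IsManifold.maximalAtlas 𝓘(ℂ, ℂ × ℂ) ω X,
    p ∈ χ.source ∧ χ p = 0 ∧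
      ((∃ i, ∀ q ∈ χ.source, (q ∈ C i ↔ (χ q).1 = 0) ∧ ∀ k, k ≠ i → q ∉ C k) ∨
        (∃ i j, i ≠ j ∧ ∀ q ∈ χ.source, (q ∈ C i ↔ (χ q).1 = 0) ∧ (q ∈ C j ↔ (χ q).2 = 0) ∧
          ∀ k, k ≠ i → k ≠ j → q ∉ C k))

/-- `T(C)`: the group of line bundles on `C = ⋃ i, C i` that are trivial on every component. -/
def componentwiseTrivial {n : ℕ} (C : Fin n → Set X) : Subgroup (Pic (⋃ i, C i)) :=
  ⨅ i, (Pic.restrict (Set.subset_iUnion C i)).ker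

/-- The vertices of the dual graph of the curve `⋃ i, C i`, one for each component. -/
structure DualGraph {n : ℕ} (C : Fin n → Set X) where
  component : Fin n

/-- The dual graph of `⋃ i, C i`, with its orientation by the order of the indices: for `i < j` the
edges from `C i` to `C j` are the points of `C i ∩ C j`. -/
instance {n : ℕ} (C : Fin n → Set X) : Quiver (DualGraph C) where
  Hom a b := {p : X // a.component < b.component ∧ p ∈ C a.component ∩ C b.component}

end Picard

/-! ## Cohomology and fundamental group of a graph -/

section Graph

variable (V : Type*) [Quiver V]

/-- The coboundary `C⁰(Γ, A) → C¹(Γ, A)` of an oriented graph `Γ` with vertex set `V`, for an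
abelian group `A` written multiplicatively. -/
def graphCoboundary (A : Type*) [CommGroup A] : (V → A) →* (Quiver.Total V → A) where
  toFun f e := f e.right / f e.left
  map_one' := by ext; simp
  map_mul' f g := by ext; simp [mul_div_mul_comm]

/-- The first cohomology group `H¹(Γ, A)` of a graph: as there are no cells of dimension two, it is
the quotient of all 1-cochains by the coboundaries. -/
abbrev GraphH1 (A : Type*) [CommGroup A] : Type _ :=
  (Quiver.Total V → A) ⧸ (graphCoboundary V A).range

variable {V}

/-- The fundamental group `π₁(Γ, v)` of a graph: the group of closed edge paths at `v`, in which
edges can be traversed in both directions, modulo insertion and deletion of backtracking. -/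
abbrev GraphPi1 (v : V) : Type _ :=
  (Quiver.FreeGroupoid.of V).obj v ⟶ (Quiver.FreeGroupoid.of V).obj v

end Graph

/-! A line bundle that is trivial on every component is glued from the bundles `𝒪` on the components
by one nonzero scalar per node. The scalar at the node of an edge is the ratio of the two
trivializations there, so the gluing data form a 1-cochain of the dual graph. Every cochain occurs:
`cochainBundle` realizes it, and `nonempty_cochainBundle_iso` identifies this bundle with any bundle
having the same ratios. Hence `cochainPic` is a homomorphism with image `T(C)`.

Its kernel consists of the coboundaries because a trivialization on a component is unique up to a
constant (`IsSNCCurve.exists_eq_mul`): the component is compact and connected, so the maximum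
principle applies. Simple normal crossings enter through `IsSNCCurve.holomorphicOn_iUnion`:
functions that are holomorphic on both branches and agree at the node come from a holomorphic
function on the surface.

The second isomorphism is combinatorial. A cochain is evaluated on closed paths; in a connected
graph, paths from the base point to all vertices yield both surjectivity and the kernel.
Connectedness of the graph follows from that of the curve (`IsSNCCurve.nonempty_path`). -/

/-! ### Cochains of a graph and characters of its fundamental group -/

section GraphCohomology

open CategoryTheory

variable {V : Type*} [Quiver V] {A : Type*} [CommGroup A]

/-- Two functors from a free groupoid to an abelian group agree if they agree on edges. -/
theorem FreeGroupoid.map_eq_of_map_of_eq (Φ Ψ : Quiver.FreeGroupoid V ⥤ SingleObj A)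
    (h : ∀ (a b : V) (e : a ⟶ b), (Φ.map ((Quiver.FreeGroupoid.of V).map e) : A) =
      Ψ.map ((Quiver.FreeGroupoid.of V).map e))
    {x y : Quiver.FreeGroupoid V} (γ : x ⟶ y) : (Φ.map γ : A) = Ψ.map γ := by
  have key : Φ = Ψ := by
    rw [Quiver.FreeGroupoid.lift_unique _ Φ rfl, Quiver.FreeGroupoid.lift_unique _ Ψ rfl]
    congr 1
    exact Prefunctor.ext (fun _ => rfl) h
  rw [key]

/-- The functor from the fundamental groupoid of a graph to `A` that is given by a 1-cochain. -/
def cochainFunctor (c : Quiver.Total V → A) : Quiver.FreeGroupoid V ⥤ SingleObj A :=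
  Quiver.FreeGroupoid.lift
    { obj := fun _ => SingleObj.star A
      map := fun {a b} e => c ⟨a, b, e⟩ }

/-- The product of the values of a 1-cochain along an edge path. -/
def transport (c : Quiver.Total V → A) {x y : Quiver.FreeGroupoid V} (γ : x ⟶ y) : A :=
  (cochainFunctor c).map γ

theorem transport_of (c : Quiver.Total V → A) {a b : V} (e : a ⟶ b) :
    transport c ((Quiver.FreeGroupoid.of V).map e) = c ⟨a, b, e⟩ :=
  Prefunctor.congr_hom (Quiver.FreeGroupoid.lift_spec (V' := SingleObj A)
    { obj := fun _ => SingleObj.star A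
      map := fun {a b} e => c ⟨a, b, e⟩ }) e

theorem transport_id (c : Quiver.Total V → A) (x : Quiver.FreeGroupoid V) :
    transport c (𝟙 x) = 1 :=
  (cochainFunctor c).map_id x

theorem transport_comp (c : Quiver.Total V → A) {x y z : Quiver.FreeGroupoid V}
    (γ : x ⟶ y) (δ : y ⟶ z) : transport c (γ ≫ δ) = transport c γ * transport c δ :=
  -- Composition in `SingleObj A` is multiplication in the reverse order.
  ((cochainFunctor c).map_comp γ δ).trans (mul_comm _ _)

theorem transport_inv (c : Quiver.Total V → A) {x y : Quiver.FreeGroupoid V}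
    (γ : x ⟶ y) : transport c (Groupoid.inv γ) = (transport c γ)⁻¹ := by
  rw [eq_inv_iff_mul_eq_one, ← transport_comp, Groupoid.inv_comp, transport_id]

/-- A multiplicative function on edge paths is the transport of its restriction to edges. -/
theorem eq_transport (m : ∀ {x y : Quiver.FreeGroupoid V}, (x ⟶ y) → A)
    (hm : ∀ {x y z : Quiver.FreeGroupoid V} (γ : x ⟶ y) (δ : y ⟶ z), m (γ ≫ δ) = m γ * m δ)
    {x y : Quiver.FreeGroupoid V} (γ : x ⟶ y) :
    m γ = transport (fun e => m ((Quiver.FreeGroupoid.of V).map e.hom)) γ := by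
  let Φ : Quiver.FreeGroupoid V ⥤ SingleObj A :=
    { obj := fun _ => SingleObj.star A
      map := fun γ => m γ
      map_id := fun x => by
        have h := hm (𝟙 x) (𝟙 x)
        rw [Category.comp_id, left_eq_mul] at h
        exact h
      map_comp := fun γ δ => (hm γ δ).trans (mul_comm _ _) }
  exact FreeGroupoid.map_eq_of_map_of_eq Φ (cochainFunctor _)
    (fun a b e => (transport_of (fun e => m ((Quiver.FreeGroupoid.of V).map e.hom)) e).symm) γ

theorem transport_mul (c d : Quiver.Total V → A) {x y : Quiver.FreeGroupoid V} (γ : x ⟶ y) :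
    transport (c * d) γ = transport c γ * transport d γ := by
  rw [eq_transport (fun γ => transport c γ * transport d γ) (fun γ δ => by
    simp only [transport_comp, mul_mul_mul_comm]) γ]
  congr 1
  ext e
  simp [transport_of]

/-- Evaluation of 1-cochains on closed edge paths. -/
def holonomy (A : Type*) [CommGroup A] (v : V) : (Quiver.Total V → A) →* (GraphPi1 v →* A) where
  toFun c :=
    { toFun := fun γ => transport c γ
      map_one' := transport_id c _
      map_mul' := fun γ δ => transport_comp c γ δ }
  map_one' := by
    ext γ
    have h := transport_mul (1 : Quiver.Total V → A) 1 γ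
    rw [mul_one, left_eq_mul] at h
    exact h
  map_mul' c d := by
    ext γ
    exact transport_mul c d γ

theorem holonomy_apply (v : V) (c : Quiver.Total V → A) (γ : GraphPi1 v) :
    holonomy A v c γ = transport c γ := rfl

theorem Groupoid.conj_comp {G : Type*} [Groupoid G] {v x y z w : G} (s : v ⟶ x) (u : v ⟶ y)
    (r : z ⟶ w) (γ : x ⟶ y) (δ : y ⟶ z) :
    s ≫ (γ ≫ δ) ≫ r = (s ≫ γ ≫ Groupoid.inv u) ≫ u ≫ δ ≫ r := by
  simp

/-- The paths `t` close any path up to a loop at `v`. This extends a character of loops to a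
multiplicative function on all paths, and such a function is the transport of a cochain. -/
theorem holonomy_surjective {v : V}
    (t : ∀ w : V, (Quiver.FreeGroupoid.of V).obj v ⟶ (Quiver.FreeGroupoid.of V).obj w) :
    Function.Surjective (holonomy A v) := by
  intro ρ
  let τ : ∀ x : Quiver.FreeGroupoid V, (Quiver.FreeGroupoid.of V).obj v ⟶ x := fun x => t x.as
  let m : ∀ {x y : Quiver.FreeGroupoid V}, (x ⟶ y) → A := fun {x y} γ =>
    ρ (τ x ≫ γ ≫ Groupoid.inv (τ y))
  have hm : ∀ {x y z : Quiver.FreeGroupoid V} (γ : x ⟶ y) (δ : y ⟶ z),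
      m (γ ≫ δ) = m γ * m δ := by
    intro x y z γ δ
    exact (congrArg ρ (Groupoid.conj_comp (τ x) (τ y) (Groupoid.inv (τ z)) γ δ)).trans
      (map_mul ρ _ _)
  refine ⟨fun e => m ((Quiver.FreeGroupoid.of V).map e.hom), ?_⟩
  ext γ
  refine (eq_transport m hm γ).symm.trans ?_
  -- The path `t v` need not be trivial, but conjugation by it is invisible in the abelian group
  -- `A`.
  have : ρ (t v * γ * (t v)⁻¹) = ρ γ := by
    rw [map_mul, map_mul, map_inv, mul_inv_cancel_comm]
  rw [← this, mul_assoc]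
  rfl

/-- If all loops have trivial holonomy, transport from `v` depends only on the end point and is a
primitive of `c`. Conversely, the transport of a coboundary telescopes to `f y / f x`. -/
theorem ker_holonomy {v : V}
    (t : ∀ w : V, (Quiver.FreeGroupoid.of V).obj v ⟶ (Quiver.FreeGroupoid.of V).obj w) :
    (holonomy A v).ker = (graphCoboundary V A).range := by
  ext c
  rw [MonoidHom.mem_ker]
  constructor
  · intro h
    refine ⟨fun w => transport c (t w), ?_⟩
    ext ⟨a, b, e⟩
    -- The loop that goes out along `t a`, crosses the edge and returns along `t b`.
    have h1 := DFunLike.congr_fun h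
      (t a ≫ (Quiver.FreeGroupoid.of V).map e ≫ Groupoid.inv (t b))
    rw [holonomy_apply, transport_comp, transport_comp, transport_inv, transport_of,
      MonoidHom.one_apply, ← mul_assoc, mul_inv_eq_one] at h1
    change transport c (t b) / transport c (t a) = _
    rw [← h1, mul_div_cancel_left]
  · rintro ⟨f, rfl⟩
    ext γ
    rw [holonomy_apply]
    have h := eq_transport (A := A) (fun {x y} _ => f y.as / f x.as) (fun γ δ => by
      rw [mul_comm, div_mul_div_cancel]) γ
    refine h.symm.trans ?_
    simp

/-- For a connected graph, `H¹(Γ, A)` is `Hom(π₁(Γ, v), A)`. -/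
theorem nonempty_graphH1_mulEquiv {v : V}
    (t : ∀ w : V, (Quiver.FreeGroupoid.of V).obj v ⟶ (Quiver.FreeGroupoid.of V).obj w) :
    Nonempty (GraphH1 V A ≃* (GraphPi1 v →* A)) :=
  ⟨(QuotientGroup.quotientMulEquivOfEq (ker_holonomy t).symm).trans
    (QuotientGroup.quotientKerEquivOfSurjective _ (holonomy_surjective t))⟩

end GraphCohomology

/-! ### Holomorphic functions in charts and the maximum principle -/

section Analysis

variable {X : Type u} [TopologicalSpace X] [ChartedSpace (ℂ × ℂ) X]

theorem HolomorphicOn.congr {Z V : Set X} {f g : X → ℂ} (hf : HolomorphicOn Z V f)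
    (h : ∀ q ∈ Z ∩ V, f q = g q) (hV : IsOpen V) : HolomorphicOn Z V g :=
  HolomorphicOn.of_local (fun _ hp => ⟨V, hV, hp.2, f, hf, fun q hq => h q hq.1⟩) hV

theorem HolomorphicOn.continuousOn {Z V : Set X} {f : X → ℂ} (hf : HolomorphicOn Z V f) :
    ContinuousOn f (Z ∩ V) := by
  intro p hp
  obtain ⟨W, hW, hpW, F, hF, hFf⟩ := hf p hp
  have h1 : ContinuousAt F p := (hF.continuousOn p hpW).continuousAt (hW.mem_nhds hpW)
  refine h1.continuousWithinAt.congr_of_eventuallyEq ?_ (hFf p ⟨hpW, hp.1⟩).symm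
  filter_upwards [self_mem_nhdsWithin, mem_nhdsWithin_of_mem_nhds (hW.mem_nhds hpW)] with q hq hqW
  exact (hFf q ⟨hqW, hq.1⟩).symm

/-- In a chart, a holomorphic function on an open set is holomorphic. -/
theorem differentiableOn_comp_chart_symm {χ : OpenPartialHomeomorph X (ℂ × ℂ)}
    (hχ : χ ∈ IsManifold.maximalAtlas 𝓘(ℂ, ℂ × ℂ) ω X) {W : Set X} {F : X → ℂ}
    (hF : MDifferentiableOn 𝓘(ℂ, ℂ × ℂ) 𝓘(ℂ, ℂ) F W) :
    DifferentiableOn ℂ (F ∘ χ.symm) (χ.target ∩ χ.symm ⁻¹' W) := by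
  rw [← mdifferentiableOn_iff_differentiableOn]
  exact hF.comp (((contMDiffOn_symm_of_mem_maximalAtlas hχ).mdifferentiableOn
    (by simp)).mono Set.inter_subset_left) Set.inter_subset_right

/-- A function that is holomorphic in a chart is holomorphic. -/
theorem mdifferentiableOn_comp_chart {χ : OpenPartialHomeomorph X (ℂ × ℂ)}
    (hχ : χ ∈ IsManifold.maximalAtlas 𝓘(ℂ, ℂ × ℂ) ω X) {O : Set (ℂ × ℂ)} {G : ℂ × ℂ → ℂ}
    (hG : DifferentiableOn ℂ G O) :
    MDifferentiableOn 𝓘(ℂ, ℂ × ℂ) 𝓘(ℂ, ℂ) (G ∘ χ) (χ.source ∩ χ ⁻¹' O) := by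
  rw [← mdifferentiableOn_iff_differentiableOn] at hG
  exact hG.comp (((contMDiffOn_of_mem_maximalAtlas hχ).mdifferentiableOn
    (by simp)).mono Set.inter_subset_left) Set.inter_subset_right

/-- A holomorphic function on a subset `Z` that is a coordinate line near `p` is locally constant
near a point where its absolute value is maximal. The coordinate line is the image of `l`. -/
theorem HolomorphicOn.eventually_eq_of_isMaxOn {Z : Set X} {f : X → ℂ}
    (hf : HolomorphicOn Z Set.univ f) {p : X} (hp : p ∈ Z) (hmax : ∀ q ∈ Z, ‖f q‖ ≤ ‖f p‖)
    {χ : OpenPartialHomeomorph X (ℂ × ℂ)} (hχ : χ ∈ IsManifold.maximalAtlas 𝓘(ℂ, ℂ × ℂ) ω X)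
    (hpχ : p ∈ χ.source) (h0 : χ p = 0) (l : ℂ →L[ℂ] ℂ × ℂ) (π : ℂ × ℂ →L[ℂ] ℂ)
    (hl : ∀ t, χ.symm (l t) ∈ Z ∨ l t ∉ χ.target)
    (hπ : ∀ q ∈ χ.source, q ∈ Z → l (π (χ q)) = χ q) :
    ∃ W, IsOpen W ∧ p ∈ W ∧ ∀ q ∈ W ∩ Z, f q = f p := by
  obtain ⟨W, hW, hpW, F, hF, hFf⟩ := hf p ⟨hp, trivial⟩
  have hO : IsOpen (χ.target ∩ χ.symm ⁻¹' W) := χ.symm.isOpen_inter_preimage hW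
  have hsymm0 : χ.symm 0 = p := by rw [← h0, χ.left_inv hpχ]
  have h0O : (0 : ℂ × ℂ) ∈ χ.target ∩ χ.symm ⁻¹' W :=
    ⟨h0 ▸ χ.map_source hpχ, by rwa [Set.mem_preimage, hsymm0]⟩
  have hG := differentiableOn_comp_chart_symm hχ hF
  have hlO : ∀ᶠ t in nhds (0 : ℂ), l t ∈ χ.target ∩ χ.symm ⁻¹' W :=
    l.continuous.continuousAt.eventually_mem (hO.mem_nhds (by rwa [map_zero]))
  have hval : ∀ t, l t ∈ χ.target ∩ χ.symm ⁻¹' W → F (χ.symm (l t)) = f (χ.symm (l t)) ∧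
      χ.symm (l t) ∈ Z := fun t ht => by
    have := (hl t).resolve_right (not_not.2 ht.1)
    exact ⟨hFf _ ⟨ht.2, this⟩, this⟩
  -- The maximum modulus principle in one variable, for the pullback of `F` to the coordinate line.
  have hev := Complex.eventually_eq_of_isLocalMax_norm (f := fun t => F (χ.symm (l t))) (c := 0)
    (by
      filter_upwards [hlO] with t ht
      exact (hG.differentiableAt (hO.mem_nhds ht)).comp t l.differentiableAt)
    (by
      filter_upwards [hlO] with t ht
      simp only [Function.comp, map_zero, hsymm0]
      rw [(hval t ht).1, hFf p ⟨hpW, hp⟩]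
      exact hmax _ (hval t ht).2)
  have hev2 : ∀ᶠ t in nhds (0 : ℂ), f (χ.symm (l t)) = f p := by
    filter_upwards [hev, hlO] with t ht htO
    rw [← (hval t htO).1, ht, map_zero, hsymm0, hFf p ⟨hpW, hp⟩]
  have hcont : Filter.Tendsto (fun q => π (χ q)) (nhds p) (nhds 0) := by
    have := (π.continuous.continuousAt (x := χ p)).comp (χ.continuousAt hpχ)
    simpa [ContinuousAt, Function.comp_def, h0] using this
  have hev3 := (hcont.eventually hev2).and (χ.open_source.mem_nhds hpχ)
  obtain ⟨W', hW', hoW', hpW'⟩ := mem_nhds_iff.1 hev3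
  refine ⟨W', hoW', hpW', fun q hq => ?_⟩
  have h := hW' hq.1
  rw [← h.1]
  rw [hπ q h.2 hq.2, χ.left_inv h.2]

end Analysis

/-! ### Components, connectedness and holomorphic functions of a normal crossing curve -/

section Curve

variable {X : Type u} [TopologicalSpace X] [ChartedSpace (ℂ × ℂ) X]
  {n : ℕ} {C : Fin n → Set X}

theorem IsSNCCurve.isClosed_iUnion [T2Space X] (hC : IsSNCCurve C) : IsClosed (⋃ i, C i) :=
  hC.isCompact.isClosed

/-- The components of a curve are closed. -/
theorem IsSNCCurve.isClosed_component [T2Space X] (hC : IsSNCCurve C) (k : Fin n) :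
    IsClosed (C k) := by
  refine isClosed_of_closure_subset fun p hp => ?_
  have hpC : p ∈ ⋃ i, C i :=
    closure_minimal (Set.subset_iUnion C k) hC.isClosed_iUnion hp
  obtain ⟨χ, -, hpχ, h0, h⟩ := hC.exists_chart p hpC
  -- The component meets the chart at `q`, so it is one of the coordinate lines there, and these
  -- pass through the centre `p`.
  obtain ⟨q, hq, hqk⟩ := mem_closure_iff.1 hp _ χ.open_source hpχ
  rcases h with ⟨i, h⟩ | ⟨i, j, -, h⟩
  · by_cases hk : k = i
    · rw [hk, (h p hpχ).1, h0]; rfl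
    · exact absurd hqk ((h q hq).2 k hk)
  · by_cases hk : k = i
    · rw [hk, (h p hpχ).1, h0]; rfl
    by_cases hk' : k = j
    · rw [hk', (h p hpχ).2.1, h0]; rfl
    · exact absurd hqk ((h q hq).2.2 k hk hk')

theorem IsSNCCurve.isCompact_component [T2Space X] (hC : IsSNCCurve C) (k : Fin n) :
    IsCompact (C k) :=
  hC.isCompact.of_isClosed_subset (hC.isClosed_component k) (Set.subset_iUnion C k)

/-- Two vertices of the dual graph are joined by an edge path. -/
theorem IsSNCCurve.nonempty_path [T2Space X] (hC : IsSNCCurve C) (v w : DualGraph C) :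
    Nonempty ((Quiver.FreeGroupoid.of (DualGraph C)).obj v ⟶
      (Quiver.FreeGroupoid.of (DualGraph C)).obj w) := by
  let R : Fin n → Prop := fun k => Nonempty ((Quiver.FreeGroupoid.of (DualGraph C)).obj v ⟶
      (Quiver.FreeGroupoid.of (DualGraph C)).obj ⟨k⟩)
  have hR : ∀ k l : Fin n, ∀ p ∈ C k ∩ C l, R k → R l := by
    rintro k l p hp ⟨γ⟩
    rcases lt_trichotomy k l with hkl | rfl | hkl
    · exact ⟨CategoryTheory.CategoryStruct.comp γ ((Quiver.FreeGroupoid.of (DualGraph C)).map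
        (X := ⟨k⟩) (Y := ⟨l⟩) ⟨p, hkl, hp⟩)⟩
    · exact ⟨γ⟩
    · exact ⟨CategoryTheory.CategoryStruct.comp γ (CategoryTheory.Groupoid.inv
        ((Quiver.FreeGroupoid.of (DualGraph C)).map (X := ⟨l⟩) (Y := ⟨k⟩) ⟨p, hkl, hp.2, hp.1⟩))⟩
  by_contra hw
  have hw' : ¬ R w.component := hw
  have hv' : R v.component := ⟨CategoryTheory.CategoryStruct.id _⟩
  obtain ⟨a, ha⟩ := (hC.isConnected_component v.component).nonempty
  obtain ⟨b, hb⟩ := (hC.isConnected_component w.component).nonempty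
  -- The components that can be reached from `v` and the others form two closed sets covering the
  -- connected curve; a common point is an edge between them.
  obtain ⟨p, -, hp1, hp2⟩ := isPreconnected_closed_iff.1 hC.isConnected.isPreconnected
    (⋃ k : {k // R k}, C k) (⋃ k : {k // ¬ R k}, C k)
    (isClosed_iUnion_of_finite fun k => hC.isClosed_component k)
    (isClosed_iUnion_of_finite fun k => hC.isClosed_component k)
    (by
      intro q hq
      obtain ⟨k, hk⟩ := Set.mem_iUnion.1 hq
      by_cases h : R k
      · exact Or.inl (Set.mem_iUnion.2 ⟨⟨k, h⟩, hk⟩)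
      · exact Or.inr (Set.mem_iUnion.2 ⟨⟨k, h⟩, hk⟩))
    ⟨a, Set.mem_iUnion.2 ⟨_, ha⟩, Set.mem_iUnion.2 ⟨⟨_, hv'⟩, ha⟩⟩
    ⟨b, Set.mem_iUnion.2 ⟨_, hb⟩, Set.mem_iUnion.2 ⟨⟨_, hw'⟩, hb⟩⟩
  obtain ⟨⟨k, hk⟩, hpk⟩ := Set.mem_iUnion.1 hp1
  obtain ⟨⟨l, hl⟩, hpl⟩ := Set.mem_iUnion.1 hp2
  exact hl (hR k l p ⟨hpk, hpl⟩ hk)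

/-- Global holomorphic functions on a component are constant. -/
theorem IsSNCCurve.eq_of_holomorphicOn [T2Space X] (hC : IsSNCCurve C) {k : Fin n} {f : X → ℂ}
    (hf : HolomorphicOn (C k) Set.univ f) {p q : X} (hp : p ∈ C k) (hq : q ∈ C k) :
    f p = f q := by
  have hcont : ContinuousOn f (C k) := by simpa using hf.continuousOn
  obtain ⟨m, hm, hmax⟩ := (hC.isCompact_component k).exists_isMaxOn
    (hC.isConnected_component k).nonempty hcont.norm
  -- Wherever `f` takes the value `f m`, its modulus is again maximal, so the locus `f = f m` is
  -- open in `C k`.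
  have hloc : ∀ x ∈ C k, f x = f m → ∃ W, IsOpen W ∧ x ∈ W ∧ ∀ y ∈ W ∩ C k, f y = f m := by
    intro x hx hxm
    have hmax' : ∀ y ∈ C k, ‖f y‖ ≤ ‖f x‖ := fun y hy => by rw [hxm]; exact hmax hy
    rw [← hxm]
    obtain ⟨χ, hχ, hxχ, h0, h⟩ := hC.exists_chart x (Set.mem_iUnion.2 ⟨k, hx⟩)
    have hfst : (∀ y ∈ χ.source, (y ∈ C k ↔ (χ y).1 = 0)) →
        ∃ W, IsOpen W ∧ x ∈ W ∧ ∀ y ∈ W ∩ C k, f y = f x := fun h =>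
      hf.eventually_eq_of_isMaxOn hx hmax' hχ hxχ h0 (ContinuousLinearMap.inr ℂ ℂ ℂ)
        (ContinuousLinearMap.snd ℂ ℂ ℂ)
        (fun t => by
          by_cases ht : ContinuousLinearMap.inr ℂ ℂ ℂ t ∈ χ.target
          · left
            rw [h _ (χ.map_target ht), χ.right_inv ht]
            simp
          · exact Or.inr ht)
        fun y hy hyk => Prod.ext ((h y hy).1 hyk).symm rfl
    have hsnd : (∀ y ∈ χ.source, (y ∈ C k ↔ (χ y).2 = 0)) →
        ∃ W, IsOpen W ∧ x ∈ W ∧ ∀ y ∈ W ∩ C k, f y = f x := fun h =>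
      hf.eventually_eq_of_isMaxOn hx hmax' hχ hxχ h0 (ContinuousLinearMap.inl ℂ ℂ ℂ)
        (ContinuousLinearMap.fst ℂ ℂ ℂ)
        (fun t => by
          by_cases ht : ContinuousLinearMap.inl ℂ ℂ ℂ t ∈ χ.target
          · left
            rw [h _ (χ.map_target ht), χ.right_inv ht]
            simp
          · exact Or.inr ht)
        fun y hy hyk => Prod.ext rfl ((h y hy).1 hyk).symm
    rcases h with ⟨i, h⟩ | ⟨i, j, -, h⟩
    · have hk : k = i := by
        by_contra hk
        exact (h x hxχ).2 k hk hx
      subst hk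
      exact hfst fun y hy => (h y hy).1
    · by_cases hk : k = i
      · subst hk
        exact hfst fun y hy => (h y hy).1
      · have hk' : k = j := by
          by_contra hk'
          exact (h x hxχ).2.2 k hk hk' hx
        subst hk'
        exact hsnd fun y hy => (h y hy).2.1
  choose! W hWo hWx hW using hloc
  -- The locus is also closed by continuity, hence all of the connected set `C k`.
  have hall : ∀ x ∈ C k, f x = f m := by
    by_contra! hne
    obtain ⟨x, hx, hxm⟩ := hne
    obtain ⟨O, hO, hOeq⟩ := continuousOn_iff'.1 hcont {f m}ᶜ isOpen_compl_singleton
    have hO' : ∀ y ∈ C k, y ∈ O ↔ f y ≠ f m := fun y hy => by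
      have := Set.ext_iff.1 hOeq y
      simp only [Set.mem_inter_iff, Set.mem_preimage, Set.mem_compl_iff, Set.mem_singleton_iff,
        hy, and_true] at this
      exact this.symm
    obtain ⟨y, hy, hy1, hy2⟩ := (hC.isConnected_component k).isPreconnected
      (⋃ z : {z // z ∈ C k ∧ f z = f m}, W z) O
      (isOpen_iUnion fun z => hWo z z.2.1 z.2.2) hO
      (fun y hy => by
        by_cases h : f y = f m
        · exact Or.inl (Set.mem_iUnion.2 ⟨⟨y, hy, h⟩, hWx y hy h⟩)
        · exact Or.inr ((hO' y hy).2 h))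
      ⟨m, hm, Set.mem_iUnion.2 ⟨⟨m, hm, rfl⟩, hWx m hm rfl⟩⟩
      ⟨x, hx, (hO' x hx).2 hxm⟩
    obtain ⟨z, hz⟩ := Set.mem_iUnion.1 hy1
    exact (hO' y hy).1 hy2 (hW z z.2.1 z.2.2 y ⟨hz, hy⟩)
  rw [hall p hp, hall q hq]

/-- A function on a curve is holomorphic if its restrictions to the components are. -/
theorem IsSNCCurve.holomorphicOn_iUnion (hC : IsSNCCurve C) {V : Set X} {f : X → ℂ}
    (hf : ∀ k, HolomorphicOn (C k) V f) : HolomorphicOn (⋃ k, C k) V f := by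
  intro p hp
  obtain ⟨χ, hχ, hpχ, h0, h⟩ := hC.exists_chart p hp.1
  rcases h with ⟨i, h⟩ | ⟨i, j, -, h⟩
  · have hpi : p ∈ C i := by rw [(h p hpχ).1, h0]; rfl
    obtain ⟨W, hW, hpW, F, hF, hFf⟩ := hf i p ⟨hpi, hp.2⟩
    refine ⟨W ∩ χ.source, hW.inter χ.open_source, ⟨hpW, hpχ⟩, F, hF.mono Set.inter_subset_left, ?_⟩
    rintro q ⟨⟨hqW, hqχ⟩, hq⟩
    obtain ⟨k, hk⟩ := Set.mem_iUnion.1 hq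
    have hki : k = i := by
      by_contra hki
      exact (h q hqχ).2 k hki hk
    subst hki
    exact hFf q ⟨hqW, hk⟩
  · have hpi : p ∈ C i := by rw [(h p hpχ).1, h0]; rfl
    have hpj : p ∈ C j := by rw [(h p hpχ).2.1, h0]; rfl
    obtain ⟨W, hW, hpW, F, hF, hFf⟩ := hf i p ⟨hpi, hp.2⟩
    obtain ⟨W', hW', hpW', F', hF', hFf'⟩ := hf j p ⟨hpj, hp.2⟩
    have hsymm0 : χ.symm 0 = p := by rw [← h0, χ.left_inv hpχ]
    have h0t : (0 : ℂ × ℂ) ∈ χ.target := h0 ▸ χ.map_source hpχ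
    -- on `z = 0` and on `w = 0`, extend along the other coordinate
    let l : ℂ × ℂ →L[ℂ] ℂ × ℂ :=
      (ContinuousLinearMap.inr ℂ ℂ ℂ).comp (ContinuousLinearMap.snd ℂ ℂ ℂ)
    let l' : ℂ × ℂ →L[ℂ] ℂ × ℂ :=
      (ContinuousLinearMap.inl ℂ ℂ ℂ).comp (ContinuousLinearMap.fst ℂ ℂ ℂ)
    let O : Set (ℂ × ℂ) := l ⁻¹' (χ.target ∩ χ.symm ⁻¹' W) ∩ l' ⁻¹' (χ.target ∩ χ.symm ⁻¹' W')
    have hO : IsOpen O := ((χ.symm.isOpen_inter_preimage hW).preimage l.continuous).inter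
      ((χ.symm.isOpen_inter_preimage hW').preimage l'.continuous)
    -- The extension is `F(0, w) + F'(z, 0) - f(p)`. On each axis one summand is the constant
    -- `f(p)`, which cancels, and the other is `f`.
    have hG : DifferentiableOn ℂ (fun x => (F ∘ χ.symm) (l x) + (F' ∘ χ.symm) (l' x) - f p) O :=
      (((differentiableOn_comp_chart_symm hχ hF).comp l.differentiableOn fun x hx => hx.1).add
        ((differentiableOn_comp_chart_symm hχ hF').comp l'.differentiableOn
          fun x hx => hx.2)).sub_const _
    refine ⟨χ.source ∩ χ ⁻¹' O, χ.isOpen_inter_preimage hO, ⟨hpχ, ?_⟩, _,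
      mdifferentiableOn_comp_chart hχ hG, ?_⟩
    · rw [Set.mem_preimage, h0]
      simp only [O, Set.mem_inter_iff, Set.mem_preimage, map_zero, hsymm0]
      exact ⟨⟨h0t, hpW⟩, h0t, hpW'⟩
    · rintro q ⟨⟨hqχ, hqO⟩, hq⟩
      obtain ⟨k, hk⟩ := Set.mem_iUnion.1 hq
      simp only [Function.comp]
      by_cases hki : k = i
      · subst hki
        have hz := (h q hqχ).1.1 hk
        have e1 : l (χ q) = χ q := Prod.ext hz.symm rfl
        have e2 : l' (χ q) = 0 := Prod.ext hz rfl
        have hqW : q ∈ W := by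
          have := hqO.1.2
          rwa [Set.mem_preimage, e1, χ.left_inv hqχ] at this
        rw [e1, e2, χ.left_inv hqχ, hsymm0, hFf q ⟨hqW, hk⟩, hFf' p ⟨hpW', hpj⟩,
          add_sub_cancel_right]
      · have hkj : k = j := by
          by_contra hkj
          exact (h q hqχ).2.2 k hki hkj hk
        subst hkj
        have hz := (h q hqχ).2.1.1 hk
        have e1 : l (χ q) = 0 := Prod.ext rfl hz
        have e2 : l' (χ q) = χ q := Prod.ext rfl hz.symm
        have hqW : q ∈ W' := by
          have := hqO.2.2
          rwa [Set.mem_preimage, e2, χ.left_inv hqχ] at this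
        rw [e1, e2, χ.left_inv hqχ, hsymm0, hFf' q ⟨hqW, hk⟩, hFf p ⟨hpW, hpi⟩,
          add_sub_cancel_left]

end Curve

/-! ### Line bundles glued from cochains of the dual graph -/

section LineBundlesOnCurves

open Classical in
/-- The function on `⋃ k, C k` that is given by `f k` on `C k`. -/
noncomputable def onComponents {X : Type*} {n : ℕ} (C : Fin n → Set X) (f : Fin n → X → ℂˣ) (x : X) : ℂˣ :=
  if h : ∃ k, x ∈ C k then f h.choose x else 1

theorem onComponents_eq {X : Type*} {n : ℕ} {C : Fin n → Set X} {f : Fin n → X → ℂˣ}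
    {x : X} (h : ∀ k l, k < l → x ∈ C k → x ∈ C l → f k x = f l x) {k : Fin n} (hk : x ∈ C k) :
    onComponents C f x = f k x := by
  have hex : ∃ k, x ∈ C k := ⟨k, hk⟩
  rw [onComponents, dif_pos hex]
  rcases lt_trichotomy hex.choose k with h1 | h1 | h1
  · exact h _ _ h1 hex.choose_spec hk
  · rw [h1]
  · exact (h _ _ h1 hk hex.choose_spec).symm

variable {X : Type u} [TopologicalSpace X] [ChartedSpace (ℂ × ℂ) X]
  {n : ℕ} {C : Fin n → Set X}

/-- At most two components pass through a point. -/
theorem IsSNCCurve.eq_or_eq (hC : IsSNCCurve C) {p : X} {i j k : Fin n} (hi : p ∈ C i)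
    (hj : p ∈ C j) (hk : p ∈ C k) (hij : i ≠ j) : k = i ∨ k = j := by
  obtain ⟨χ, -, hpχ, -, h⟩ := hC.exists_chart p (Set.mem_iUnion.2 ⟨i, hi⟩)
  rcases h with ⟨a, h⟩ | ⟨a, b, -, h⟩
  · have key : ∀ l, p ∈ C l → l = a := fun l hl => by
      by_contra hla
      exact (h p hpχ).2 l hla hl
    exact absurd ((key i hi).trans (key j hj).symm) hij
  · have key : ∀ l, p ∈ C l → l = a ∨ l = b := fun l hl => by
      by_contra! hla
      exact (h p hpχ).2.2 l hla.1 hla.2 hl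
    have h1 := key i hi
    have h2 := key j hj
    have h3 := key k hk
    grind

/-- Every point has a neighbourhood with no other nodes. -/
theorem IsSNCCurve.exists_nhd (hC : IsSNCCurve C) (p : X) (hp : p ∈ ⋃ k, C k) :
    ∃ U : Set X, IsOpen U ∧ p ∈ U ∧
      ∀ q ∈ U, ∀ k l, k ≠ l → q ∈ C k → q ∈ C l → q = p := by
  obtain ⟨χ, -, hpχ, h0, h⟩ := hC.exists_chart p hp
  refine ⟨χ.source, χ.open_source, hpχ, fun q hq k l hkl hk hl => ?_⟩
  rcases h with ⟨a, h⟩ | ⟨a, b, -, h⟩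
  · have key : ∀ l, q ∈ C l → l = a := fun l hl => by
      by_contra hla
      exact (h q hq).2 l hla hl
    exact absurd ((key k hk).trans (key l hl).symm) hkl
  · have key : ∀ l, q ∈ C l → l = a ∨ l = b := fun l hl => by
      by_contra! hla
      exact (h q hq).2.2 l hla.1 hla.2 hl
    have h1 := key k hk
    have h2 := key l hl
    have hab : q ∈ C a ∧ q ∈ C b := by grind
    refine χ.injOn hq hpχ ?_
    rw [h0]
    exact Prod.ext ((h q hq).1.1 hab.1) ((h q hq).2.1.1 hab.2)

theorem IsSNCCurve.holomorphicOn_onComponents (hC : IsSNCCurve C)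
    {f : Fin n → X → ℂˣ} {V : Set X} (hV : IsOpen V)
    (hf : ∀ k, HolomorphicOn (C k) V fun q => (f k q : ℂ))
    (h : ∀ x ∈ V, ∀ k l, k < l → x ∈ C k → x ∈ C l → f k x = f l x) :
    HolomorphicOn (⋃ k, C k) V fun q => (onComponents C f q : ℂ) :=
  hC.holomorphicOn_iUnion fun k => (hf k).congr
    (fun q hq => by rw [onComponents_eq (h q hq.2) hq.1]) hV

open Classical in
/-- The value of the cochain `c` on the edge over `p` with end point `k`, if there is one. -/
noncomputable def edgeFactor (c : Quiver.Total (DualGraph C) → ℂˣ) (p : X) (k : Fin n) : ℂˣ :=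
  if h : ∃ e : Quiver.Total (DualGraph C), e.hom.1 = p ∧ e.right.component = k
  then c h.choose else 1

/-- Only two components pass through a node, so exactly one edge lies over it. The factor is
therefore `c e` on the branch where `e` ends and the default value 1 on the branch where it starts.
-/
theorem IsSNCCurve.edgeFactor_div (hC : IsSNCCurve C) (c : Quiver.Total (DualGraph C) → ℂˣ)
    (e : Quiver.Total (DualGraph C)) :
    edgeFactor c e.hom.1 e.right.component / edgeFactor c e.hom.1 e.left.component = c e := by
  have h1 : ∃ e' : Quiver.Total (DualGraph C),
      e'.hom.1 = e.hom.1 ∧ e'.right.component = e.right.component := ⟨e, rfl, rfl⟩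
  have h2 : ¬ ∃ e' : Quiver.Total (DualGraph C),
      e'.hom.1 = e.hom.1 ∧ e'.right.component = e.left.component := by
    rintro ⟨e', hp, hr⟩
    have ha := e.hom.2
    have hb := e'.hom.2
    rw [hp, hr] at hb
    rcases hC.eq_or_eq ha.2.1 ha.2.2 hb.2.1 ha.1.ne with h | h
    · exact hb.1.ne h
    · exact lt_asymm ha.1 (h ▸ hb.1)
  rw [edgeFactor, edgeFactor, dif_pos h1, dif_neg h2, div_one]
  congr 1
  obtain ⟨hp, hr⟩ := h1.choose_spec
  generalize h1.choose = e' at hp hr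
  obtain ⟨⟨a⟩, ⟨b⟩, ⟨p, hlt, ha, hb⟩⟩ := e
  obtain ⟨⟨a'⟩, ⟨b'⟩, ⟨p', hlt', ha', hb'⟩⟩ := e'
  dsimp only at hp hr hlt hlt' ha hb ha' hb'
  subst hp hr
  obtain rfl : a' = a := (hC.eq_or_eq ha hb ha' hlt.ne).resolve_right hlt'.ne
  rfl

/-- Two trivializations of a line bundle on a component differ by a constant. -/
theorem IsSNCCurve.exists_eq_mul [T2Space X] (hC : IsSNCCurve C)
    {k : Fin n} {L : HolLineBundle (C k)} (e e' : L.Iso (HolLineBundle.trivial (C k))) :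
    ∃ t : ℂˣ, ∀ a, ∀ x ∈ C k, x ∈ L.U a → e.φ a ⟨⟩ x = t * e'.φ a ⟨⟩ x := by
  classical
  have hex : ∀ x, ∃ s : Option L.ι, x ∈ C k → ∃ a, s = some a ∧ x ∈ L.U a := by
    intro x
    by_cases hx : x ∈ C k
    · obtain ⟨a, ha⟩ := L.cover x hx
      exact ⟨some a, fun _ => ⟨a, rfl, ha⟩⟩
    · exact ⟨none, fun h => absurd h hx⟩
  choose s hs using hex
  -- The ratio of the trivializations is independent of the frame, since the transition function
  -- cancels; it is thus a global holomorphic function.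
  let u : X → ℂˣ := fun x => (s x).elim 1 fun a => e.φ a ⟨⟩ x * (e'.φ a ⟨⟩ x)⁻¹
  have hu : ∀ a, ∀ x ∈ C k, x ∈ L.U a → u x = e.φ a ⟨⟩ x * (e'.φ a ⟨⟩ x)⁻¹ := by
    intro a x hx ha
    obtain ⟨b, hb, hxb⟩ := hs x hx
    have h1 := e.compat a b ⟨⟩ ⟨⟩ x hx ha hxb trivial trivial
    have h2 := e'.compat a b ⟨⟩ ⟨⟩ x hx ha hxb trivial trivial
    simp only [HolLineBundle.trivial, mul_one] at h1 h2
    simp only [u, hb, Option.elim_some]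
    rw [h1, h2, ← div_eq_mul_inv, ← div_eq_mul_inv, mul_div_mul_left_eq_div]
  have hol : HolomorphicOn (C k) Set.univ fun x => (u x : ℂ) := by
    refine HolomorphicOn.of_local (fun p hp => ?_) isOpen_univ
    obtain ⟨a, ha⟩ := L.cover p hp.1
    refine ⟨L.U a, L.isOpen_U a, ha, fun x => (e.φ a ⟨⟩ x : ℂ) * ((e'.φ a ⟨⟩ x)⁻¹ : ℂˣ),
      ((e.holomorphic_φ a ⟨⟩).mul (e'.holomorphic_φ a ⟨⟩).inv).mono subset_rfl
        (fun _ h => ⟨h, trivial⟩), fun q hq => ?_⟩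
    rw [hu a q hq.1.1 hq.2, Units.val_mul]
  obtain ⟨p, hp⟩ := (hC.isConnected_component k).nonempty
  refine ⟨u p, fun a x hx ha => ?_⟩
  rw [Units.ext (hC.eq_of_holomorphicOn hol hp hx), hu a x hx ha, inv_mul_cancel_right]

/-- The line bundle on a curve that is obtained by gluing trivial line bundles on the components
at the nodes by means of the factors `c`. -/
noncomputable def cochainBundle (hC : IsSNCCurve C) (c : Quiver.Total (DualGraph C) → ℂˣ) :
    HolLineBundle (⋃ k, C k) where
  ι := {p // p ∈ ⋃ k, C k}
  U p := (hC.exists_nhd p p.2).choose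
  isOpen_U p := (hC.exists_nhd p p.2).choose_spec.1
  cover p hp := ⟨⟨p, hp⟩, (hC.exists_nhd p hp).choose_spec.2.1⟩
  -- On each component this is a coboundary of constants. At a node in both sets the centres `p` and
  -- `q` are that node, so both branches give 1.
  g p q := onComponents C fun k _ => edgeFactor c p k / edgeFactor c q k
  holomorphic_g p q := by
    refine hC.holomorphicOn_onComponents ((hC.exists_nhd p p.2).choose_spec.1.inter
      (hC.exists_nhd q q.2).choose_spec.1) (fun k => HolomorphicOn.const _ _ _)
      fun x hx k l hkl hk hl => ?_
    rw [← (hC.exists_nhd p p.2).choose_spec.2.2 x hx.1 k l hkl.ne hk hl,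
      ← (hC.exists_nhd q q.2).choose_spec.2.2 x hx.2 k l hkl.ne hk hl, div_self', div_self']
  cocycle p q r x hx hp hq hr := by
    simp only [onComponents, dif_pos (Set.mem_iUnion.1 hx), div_mul_div_cancel]

theorem eq_of_mem_cochainBundle_U (hC : IsSNCCurve C) {c : Quiver.Total (DualGraph C) → ℂˣ}
    {p : (cochainBundle hC c).ι} {x : X} (hx : x ∈ (cochainBundle hC c).U p) {k l : Fin n}
    (hkl : k ≠ l) (hk : x ∈ C k) (hl : x ∈ C l) : x = p.1 :=
  (hC.exists_nhd p.1 p.2).choose_spec.2.2 x hx k l hkl hk hl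

theorem cochainBundle_g_eq (hC : IsSNCCurve C) {c : Quiver.Total (DualGraph C) → ℂˣ}
    {p q : (cochainBundle hC c).ι} {x : X} (hp : x ∈ (cochainBundle hC c).U p)
    (hq : x ∈ (cochainBundle hC c).U q) {k : Fin n} (hk : x ∈ C k) :
    (cochainBundle hC c).g p q x = edgeFactor c p.1 k / edgeFactor c q.1 k := by
  refine onComponents_eq (f := fun k _ => edgeFactor c p.1 k / edgeFactor c q.1 k)
    (fun k l hkl hk hl => ?_) hk
  rw [← eq_of_mem_cochainBundle_U hC hp hkl.ne hk hl,
    ← eq_of_mem_cochainBundle_U hC hq hkl.ne hk hl, div_self', div_self']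

/-- The bundle `cochainBundle hC c` is trivial on the components. -/
noncomputable def cochainBundleTrivialization (hC : IsSNCCurve C)
    (c : Quiver.Total (DualGraph C) → ℂˣ) (k : Fin n) :
    ((cochainBundle hC c).restrict (Set.subset_iUnion C k)).Iso
      (HolLineBundle.trivial (C k)) where
  φ p _ _ := edgeFactor c p.1 k
  holomorphic_φ _ _ := HolomorphicOn.const _ _ _
  compat p q _ _ x hx hp hq _ _ := by
    have h := cochainBundle_g_eq (c := c) hC hp hq hx
    simp only [HolLineBundle.restrict, HolLineBundle.trivial]
    rw [h, mul_one, div_mul_cancel]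

/-- A line bundle that is trivial on the components is determined by the ratios of the
trivializations at the nodes. -/
theorem nonempty_cochainBundle_iso (hC : IsSNCCurve C) (c : Quiver.Total (DualGraph C) → ℂˣ)
    (M : HolLineBundle (⋃ k, C k))
    (e : ∀ k, (M.restrict (Set.subset_iUnion C k)).Iso (HolLineBundle.trivial (C k)))
    (hc : ∀ (E : Quiver.Total (DualGraph C)) (a : M.ι), E.hom.1 ∈ M.U a →
      c E = (e E.right.component).φ a ⟨⟩ E.hom.1 / (e E.left.component).φ a ⟨⟩ E.hom.1) :
    Nonempty ((cochainBundle hC c).Iso M) := by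
  -- On each component, the trivialization of the glued bundle followed by the inverse of that of
  -- `M`. Equality of the ratios makes the two branches agree at a node.
  let f : (cochainBundle hC c).ι → M.ι → Fin n → X → ℂˣ :=
    fun p a k x => edgeFactor c p.1 k * ((e k).φ a ⟨⟩ x)⁻¹
  have hf : ∀ p a, ∀ x ∈ (cochainBundle hC c).U p ∩ M.U a, ∀ k l, k < l → x ∈ C k → x ∈ C l →
      f p a k x = f p a l x := by
    intro p a x hx k l hkl hk hl
    have hxp := eq_of_mem_cochainBundle_U hC hx.1 hkl.ne hk hl
    let E : Quiver.Total (DualGraph C) := ⟨⟨k⟩, ⟨l⟩, ⟨x, hkl, hk, hl⟩⟩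
    have h1 : edgeFactor c x l / edgeFactor c x k = c E := hC.edgeFactor_div c E
    have h2 : c E = (e l).φ a ⟨⟩ x / (e k).φ a ⟨⟩ x := hc E a hx.2
    rw [h2, div_eq_div_iff_mul_eq_mul] at h1
    simp only [f]
    rw [← hxp, mul_inv_eq_iff_eq_mul, mul_right_comm, eq_mul_inv_iff_mul_eq, h1, mul_comm]
  refine ⟨⟨fun p a => onComponents C (f p a), fun p a => ?_, ?_⟩⟩
  · exact hC.holomorphicOn_onComponents (((cochainBundle hC c).isOpen_U p).inter (M.isOpen_U a))
      (fun k => (HolomorphicOn.const _ _ _).mul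
        (((e k).holomorphic_φ a ⟨⟩).inv.mono subset_rfl fun _ h => ⟨h.2, trivial⟩)) (hf p a)
  · intro p q a b x hx hp hq ha hb
    obtain ⟨k, hk⟩ := Set.mem_iUnion.1 hx
    rw [onComponents_eq (hf p a x ⟨hp, ha⟩) hk, onComponents_eq (hf q b x ⟨hq, hb⟩) hk,
      cochainBundle_g_eq hC hp hq hk]
    have h : (e k).φ a ⟨⟩ x * 1 = M.g a b x * (e k).φ b ⟨⟩ x :=
      (e k).compat a b ⟨⟩ ⟨⟩ x hk ha hb trivial trivial
    rw [mul_one] at h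
    simp only [f]
    rw [h, mul_inv, ← mul_assoc (_ / _), div_mul_cancel, mul_assoc, mul_right_comm,
      inv_mul_cancel, one_mul]

/-- The homomorphism from 1-cochains of the dual graph to the Picard group. -/
noncomputable def cochainPic (hC : IsSNCCurve C) :
    (Quiver.Total (DualGraph C) → ℂˣ) →* Pic (⋃ k, C k) :=
  MonoidHom.mk' (fun c => Pic.mk (cochainBundle hC c)) fun c d => by
    -- The products of the standard trivializations trivialize the tensor product on components,
    -- with ratios `c * d` at the nodes.
    refine Pic.mk_eq_mk_iff.2 (nonempty_cochainBundle_iso hC (c * d)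
      ((cochainBundle hC c).tensor (cochainBundle hC d)) (fun k =>
        { φ := fun a _ _ => edgeFactor c a.1.1 k * edgeFactor d a.2.1 k
          holomorphic_φ := fun _ _ => HolomorphicOn.const _ _ _
          compat := fun a b _ _ x hx ha hb _ _ => ?_ }) fun E a ha => ?_)
    · have h1 := (cochainBundleTrivialization hC c k).compat a.1 b.1 ⟨⟩ ⟨⟩ x hx ha.1 hb.1
        trivial trivial
      have h2 := (cochainBundleTrivialization hC d k).compat a.2 b.2 ⟨⟩ ⟨⟩ x hx ha.2 hb.2
        trivial trivial
      simp only [HolLineBundle.restrict, HolLineBundle.trivial, HolLineBundle.tensor,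
        cochainBundleTrivialization, mul_one] at h1 h2 ⊢
      rw [h1, h2, mul_mul_mul_comm]
    · have hE := E.hom.2
      dsimp only
      rw [← eq_of_mem_cochainBundle_U hC ha.1 hE.1.ne hE.2.1 hE.2.2,
        ← eq_of_mem_cochainBundle_U hC ha.2 hE.1.ne hE.2.1 hE.2.2, mul_div_mul_comm,
        hC.edgeFactor_div, hC.edgeFactor_div]
      rfl

theorem cochainPic_range (hC : IsSNCCurve C) :
    (cochainPic hC).range = componentwiseTrivial C := by
  ext F
  rw [componentwiseTrivial, Subgroup.mem_iInf]
  constructor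
  · rintro ⟨c, rfl⟩ k
    exact Pic.mk_eq_mk_iff.2 ⟨cochainBundleTrivialization hC c k⟩
  · obtain ⟨M⟩ := F
    intro h
    have h' : ∀ k, Nonempty ((M.restrict (Set.subset_iUnion C k)).Iso
        (HolLineBundle.trivial (C k))) := fun k => Pic.mk_eq_mk_iff.1 (h k)
    let e := fun k => (h' k).some
    have hmem : ∀ E : Quiver.Total (DualGraph C), E.hom.1 ∈ ⋃ k, C k := fun E =>
      Set.mem_iUnion.2 ⟨_, E.hom.2.2.1⟩
    choose a ha using fun E => M.cover _ (hmem E)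
    refine ⟨fun E => (e E.right.component).φ (a E) ⟨⟩ E.hom.1 /
      (e E.left.component).φ (a E) ⟨⟩ E.hom.1,
      Pic.mk_eq_mk_iff.2 (nonempty_cochainBundle_iso hC _ M e fun E b hb => ?_)⟩
    -- Changing the frame from `a E` to `b` multiplies both trivializations by the same transition
    -- function, so the ratio is unchanged.
    have h1 := (e E.right.component).compat (a E) b ⟨⟩ ⟨⟩ E.hom.1 E.hom.2.2.2 (ha E) hb
      trivial trivial
    have h2 := (e E.left.component).compat (a E) b ⟨⟩ ⟨⟩ E.hom.1 E.hom.2.2.1 (ha E) hb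
      trivial trivial
    simp only [HolLineBundle.restrict, HolLineBundle.trivial, mul_one] at h1 h2
    rw [h1, h2, mul_div_mul_left_eq_div]

/-- A global trivialization differs on each component from the standard one by a constant `t k`.
Comparing the two branches at a node shows that `c` is the coboundary of `t⁻¹`. Conversely, the
trivial bundle with its trivializations rescaled by constants has a coboundary as its ratios. -/
theorem cochainPic_ker [T2Space X] (hC : IsSNCCurve C) :
    (cochainPic hC).ker = (graphCoboundary (DualGraph C) ℂˣ).range := by
  ext c
  rw [MonoidHom.mem_ker]
  constructor
  · intro h
    obtain ⟨e⟩ := Pic.mk_eq_mk_iff.1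
      (show Pic.mk (cochainBundle hC c) = Pic.mk (HolLineBundle.trivial _) from h)
    choose t ht using fun k => hC.exists_eq_mul (e.restrict (Set.subset_iUnion C k))
      (cochainBundleTrivialization hC c k)
    refine ⟨fun v => (t v.component)⁻¹, ?_⟩
    ext1 E
    have hE := E.hom.2
    have hp : E.hom.1 ∈ ⋃ k, C k := Set.mem_iUnion.2 ⟨_, hE.2.1⟩
    have hpU : E.hom.1 ∈ (cochainBundle hC c).U ⟨E.hom.1, hp⟩ :=
      (hC.exists_nhd _ hp).choose_spec.2.1
    have h1 := ht E.left.component ⟨E.hom.1, hp⟩ E.hom.1 hE.2.1 hpU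
    have h2 := ht E.right.component ⟨E.hom.1, hp⟩ E.hom.1 hE.2.2 hpU
    have h3 := h1.symm.trans h2
    simp only [cochainBundleTrivialization] at h3
    rw [← hC.edgeFactor_div c E]
    change (t E.right.component)⁻¹ / (t E.left.component)⁻¹ = _
    rw [div_eq_div_iff_mul_eq_mul, inv_mul_eq_iff_eq_mul, ← mul_assoc, ← h3, mul_right_comm,
      mul_inv_cancel, one_mul]
  · rintro ⟨f, rfl⟩
    exact Pic.mk_eq_mk_iff.2 (nonempty_cochainBundle_iso hC _ (HolLineBundle.trivial _) (fun k =>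
      { φ := fun _ _ _ => f ⟨k⟩
        holomorphic_φ := fun _ _ => HolomorphicOn.const _ _ _
        compat := fun _ _ _ _ _ _ _ _ _ _ => mul_comm _ _ }) fun E _ _ => rfl)

end LineBundlesOnCurves

theorem mainTheorem10 {X : Type u} [TopologicalSpace X] [T2Space X] [ChartedSpace (ℂ × ℂ) X]
    [IsManifold 𝓘(ℂ, ℂ × ℂ) ω X] {n : ℕ} (C : Fin n → Set X) (hC : IsSNCCurve C) :
    Nonempty (componentwiseTrivial C ≃* GraphH1 (DualGraph C) ℂˣ) ∧
      ∀ v : DualGraph C, Nonempty (GraphH1 (DualGraph C) ℂˣ ≃* (GraphPi1 v →* ℂˣ)) := by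
  refine ⟨⟨?_⟩, fun v => nonempty_graphH1_mulEquiv fun w => (hC.nonempty_path v w).some⟩
  exact (MulEquiv.subgroupCongr (cochainPic_range hC).symm).trans
    ((QuotientGroup.quotientKerEquivRange (cochainPic hC)).symm.trans
      (QuotientGroup.quotientMulEquivOfEq (cochainPic_ker hC)))
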